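/- **Proposition.** For elements $a,b$ of a group write $[a,b]=a^{-1}b^{-1}ab$. For a group $G$ let $\gamma_1(G)=G$, $\gamma_{i+1}(G)=[\gamma_i(G),G]$, and let $$L(G)=\bigoplus_{i\ge 1}\gamma_i(G)/\gamma_{i+1}(G)$$ be the Lie algebra (over $\mathbb Z$) of the lower central series of $G$; its bracket is induced by the group commutator, i.e. for $x\in\gamma_i(G)$ and $y\in\gamma_j(G)$ the bracket of the classes of $x$ and $y$ is the class of $[x,y]$ in $\gamma_{i+j}(G)/\gamma_{i+j+1}(G)$. Let $F_3$ be the free group with basis $t_1,t_2,t_3$, and let $IA(F_3)$ be the group of automorphisms of $F_3$ that act trivially on $F_3/[F_3,F_3]$. Let $\alpha=(\alpha_1,\alpha_2,\alpha_3)$ be a triple of commutators $\alpha_i=[t_j,t_k]$ (with $j,k$ depending on $i$, and $k\ne i$). Then $$t_i\mapsto t_i\alpha_i,\qquad t_l\mapsto t_l\quad(l\neq i)$$ defines an element of $IA(F_3)$ for each $i$. Let $\phi_\alpha$ be the homomorphism from a second free group of rank $3$, with basis $u_1,u_2,u_3$, to $IA(F_3)$ that sends $u_i$ to this automorphism, and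 let $G_\alpha=F_3\rtimes_{\phi_\alpha}F_3$. Put $$a_1=([t_2,t_3],[t_1,t_3],[t_1,t_2]),\qquad a_2=([t_2,t_3],[t_2,t_3],[t_1,t_2]),\qquad a_3=([t_2,t_3],[t_2,t_3],[t_3,t_2]).$$ Then the Lie algebras $L(G_{a_1})$, $L(G_{a_2})$, $L(G_{a_3})$ are pairwise non-isomorphic. -/

import Mathlib

open scoped DirectSum commutatorElement

namespace LCS

/-! ### The Lie ring of the lower central series of a group -/

section Pieces

variable {G : Type*} [Group G]

/-- The lower central series, with numbering starting at `0`: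
`γ G 0 = G` and `γ G (i + 1) = [γ G i, G]`. -/
abbrev γ (G : Type*) [Group G] (i : ℕ) : Subgroup G := (⊤ : Subgroup G).lowerCentralSeries i

theorem γ_succ_le (i : ℕ) : γ G (i + 1) ≤ γ G i :=
  Subgroup.lowerCentralSeries_antitone _ (Nat.le_succ i)

/-- `[γ_i, γ_j] ≤ γ_{i+j}` (with numbering shifted by one). -/
theorem commutator_γ_le (i j : ℕ) : ⁅γ G i, γ G j⁆ ≤ γ G (i + j + 1) := by
  induction j generalizing i with
  | zero => exact le_rfl
  | succ j ih =>
    let N : Subgroup G := γ G (i + (j + 1) + 1)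
    let f : G →* G ⧸ N := QuotientGroup.mk' N
    have key : ∀ A : Subgroup G, A ≤ N → A.map f = ⊥ := by
      intro A hA
      rw [Subgroup.map_eq_bot_iff, QuotientGroup.ker_mk']
      exact hA
    have h0 : ⁅⁅γ G j, (⊤ : Subgroup G)⁆, γ G i⁆.map f = ⊥ := by
      rw [Subgroup.map_commutator, Subgroup.map_commutator]
      apply Subgroup.commutator_commutator_eq_bot_of_rotate
      · rw [← Subgroup.map_commutator, ← Subgroup.map_commutator]
        apply key
        rw [Subgroup.commutator_comm ⊤ (γ G i)]
        refine (ih (i + 1)).trans (le_of_eq ?_)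
        congr 1
        omega
      · rw [← Subgroup.map_commutator, ← Subgroup.map_commutator]
        apply key
        exact Subgroup.commutator_mono (ih i) le_rfl
    rw [Subgroup.map_eq_bot_iff, QuotientGroup.ker_mk'] at h0
    rw [Subgroup.commutator_comm]
    exact h0

theorem commutator_mem_γ {i j : ℕ} {x y : G} (hx : x ∈ γ G i) (hy : y ∈ γ G j) :
    ⁅x, y⁆ ∈ γ G (i + j + 1) :=
  commutator_γ_le i j (Subgroup.commutator_mem_commutator hx hy)

/-- The subgroup `γ G (i + 1)`, seen inside `γ G i`. -/
abbrev γsub (G : Type*) [Group G] (i : ℕ) : Subgroup (γ G i) := (γ G (i + 1)).subgroupOf (γ G i)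

/-- The quotient `γ_i / γ_{i+1}`, written multiplicatively. -/
abbrev Q (G : Type*) [Group G] (i : ℕ) : Type _ := (γ G i) ⧸ (γsub G i)

theorem Q_mk_eq {i : ℕ} {x y : γ G i} (h : (x : G)⁻¹ * y ∈ γ G (i + 1)) :
    (QuotientGroup.mk x : Q G i) = QuotientGroup.mk y :=
  QuotientGroup.eq.2 (Subgroup.mem_subgroupOf.2 h)

instance (i : ℕ) : CommGroup (Q G i) where
  mul_comm a b := by
    induction a using QuotientGroup.induction_on with | _ a => ?_
    induction b using QuotientGroup.induction_on with | _ b => ?_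
    rw [← QuotientGroup.mk_mul, ← QuotientGroup.mk_mul]
    apply Q_mk_eq
    have h : ((a * b : γ G i) : G)⁻¹ * (b * a : γ G i) = ⁅(b : G)⁻¹, (a : G)⁻¹⁆ := by
      simp [commutatorElement_def, mul_assoc]
    rw [h]
    exact Subgroup.commutator_mem_commutator (inv_mem b.2) (Subgroup.mem_top _)

/-- The abelian group `γ_i / γ_{i+1}`, written additively. -/
abbrev Piece (G : Type*) [Group G] (i : ℕ) : Type _ := Additive (Q G i)

/-- The class in `γ_i / γ_{i+1}` of an element `x` of `γ_i`. -/
def cls (i : ℕ) (x : G) (hx : x ∈ γ G i) : Q G i := QuotientGroup.mk ⟨x, hx⟩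

theorem cls_eq {i : ℕ} {x y : G} {hx : x ∈ γ G i} {hy : y ∈ γ G i}
    (h : x⁻¹ * y ∈ γ G (i + 1)) : cls i x hx = cls i y hy := Q_mk_eq h

theorem cls_mul {i : ℕ} {x y : G} (hx : x ∈ γ G i) (hy : y ∈ γ G i) :
    cls i (x * y) (mul_mem hx hy) = cls i x hx * cls i y hy := rfl

theorem cls_inv {i : ℕ} {x : G} (hx : x ∈ γ G i) :
    cls i x⁻¹ (inv_mem hx) = (cls i x hx)⁻¹ := rfl

theorem cls_eq_one {i : ℕ} {x : G} {hx : x ∈ γ G i} (h : x ∈ γ G (i + 1)) :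
    cls i x hx = 1 :=
  (QuotientGroup.eq_one_iff (N := γsub G i) (⟨x, hx⟩ : γ G i)).2 (Subgroup.mem_subgroupOf.2 h)

theorem conj_mem_γ {i : ℕ} {x : G} (hx : x ∈ γ G i) (g : G) : g * x * g⁻¹ ∈ γ G i :=
  (inferInstance : (γ G i).Normal).conj_mem x hx g

theorem cls_conj {i : ℕ} {x : G} (hx : x ∈ γ G i) (g : G) :
    cls i (g * x * g⁻¹) (conj_mem_γ hx g) = cls i x hx := by
  apply cls_eq
  have h' : (g * x * g⁻¹)⁻¹ * x = ⁅g, x⁻¹⁆ := by simp [commutatorElement_def, mul_assoc]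
  rw [h', ← commutatorElement_inv]
  exact inv_mem (Subgroup.commutator_mem_commutator (inv_mem hx) (Subgroup.mem_top _))

theorem cls_commutator_mul_right {i j : ℕ} {x y z : G} (hx : x ∈ γ G i) (hy : y ∈ γ G j)
    (hz : z ∈ γ G j) :
    cls (i + j + 1) ⁅x, y * z⁆ (commutator_mem_γ hx (mul_mem hy hz)) =
      cls (i + j + 1) ⁅x, y⁆ (commutator_mem_γ hx hy) *
        cls (i + j + 1) ⁅x, z⁆ (commutator_mem_γ hx hz) := by
  have hxz := commutator_mem_γ hx hz
  rw [← cls_conj hxz y, ← cls_mul]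
  congr 1
  rw [commutatorElement_mul_right_eq_mul_conj]
  simp only [mul_assoc]

theorem cls_commutator_mul_left {i j : ℕ} {x y z : G} (hx : x ∈ γ G i) (hy : y ∈ γ G i)
    (hz : z ∈ γ G j) :
    cls (i + j + 1) ⁅x * y, z⁆ (commutator_mem_γ (mul_mem hx hy) hz) =
      cls (i + j + 1) ⁅x, z⁆ (commutator_mem_γ hx hz) *
        cls (i + j + 1) ⁅y, z⁆ (commutator_mem_γ hy hz) := by
  have hyz := commutator_mem_γ hy hz
  rw [mul_comm, ← cls_conj hyz x, ← cls_mul]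
  congr 1
  rw [commutatorElement_mul_left_eq_conj_mul]

/-- For `x ∈ γ_i`, the homomorphism `γ_j / γ_{j+1} → γ_{i+j+1} / γ_{i+j+2}` that sends the class
of `y` to the class of `[x, y]`. -/
def brAux (i j : ℕ) (x : γ G i) : Q G j →* Q G (i + j + 1) :=
  QuotientGroup.lift (γsub G j)
    (MonoidHom.mk' (fun y : γ G j => cls (i + j + 1) ⁅(x : G), (y : G)⁆ (commutator_mem_γ x.2 y.2))
      (fun y z => cls_commutator_mul_right x.2 y.2 z.2))
    (fun _ hy => cls_eq_one
      (commutator_mem_γ (i := i) (j := j + 1) x.2 (Subgroup.mem_subgroupOf.1 hy)))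

/-- The bilinear map `γ_i / γ_{i+1} × γ_j / γ_{j+1} → γ_{i+j+1} / γ_{i+j+2}` induced by the group
commutator. -/
def brQ (i j : ℕ) : Q G i →* Q G j →* Q G (i + j + 1) :=
  QuotientGroup.lift (γsub G i)
    (MonoidHom.mk' (brAux i j) (fun x y => by
      ext z
      exact cls_commutator_mul_left x.2 y.2 z.2))
    (fun x hx => by
      ext z
      refine cls_eq_one ?_
      have h := commutator_mem_γ (Subgroup.mem_subgroupOf.1 hx) z.2
      rwa [show i + 1 + j + 1 = i + j + 1 + 1 by omega] at h)

theorem brQ_cls {i j : ℕ} {x y : G} (hx : x ∈ γ G i) (hy : y ∈ γ G j) :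
    brQ i j (cls i x hx) (cls j y hy) = cls (i + j + 1) ⁅x, y⁆ (commutator_mem_γ hx hy) := rfl

/-- `brQ`, written additively. -/
def br (i j : ℕ) : Piece G i →+ Piece G j →+ Piece G (i + j + 1) :=
  AddMonoidHom.mk' (fun a => MonoidHom.toAdditive (brQ i j a.toMul)) (fun a b => by
    ext c
    simp)

end Pieces

/-- The Lie ring `L(G) = ⨁_{i ≥ 1} γ_i(G) / γ_{i+1}(G)` of the lower central series of `G`. -/
def L (G : Type*) [Group G] : Type _ := ⨁ i : ℕ, Piece G i

section LieRing

variable {G : Type*} [Group G]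

instance : AddCommGroup (L G) :=
  inferInstanceAs (AddCommGroup (⨁ i : ℕ, Piece G i))

/-- The biadditive extension of the maps `br i j` to the direct sum. -/
def bracketHom (G : Type*) [Group G] :
    (⨁ i : ℕ, Piece G i) →+ (⨁ i : ℕ, Piece G i) →+ (⨁ i : ℕ, Piece G i) :=
  DirectSum.toAddMonoid fun i => AddMonoidHom.flip <| DirectSum.toAddMonoid fun j =>
    AddMonoidHom.flip <|
      (AddMonoidHom.compHom (DirectSum.of (fun i : ℕ => Piece G i) (i + j + 1))).comp (br i j)

/-- The bracket of `L(G)`, as a biadditive map. -/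
def lieHom : L G →+ L G →+ L G := bracketHom G

instance : Bracket (L G) (L G) := ⟨fun a b => lieHom a b⟩

/-- The inclusion of a homogeneous component in `L(G)`. -/
def incl (i : ℕ) : Piece G i →+ L G := DirectSum.of (fun i : ℕ => Piece G i) i

/-- The element of `L(G)` given by the class of `x ∈ γ_i` in `γ_i / γ_{i+1}`. -/
def toL (i : ℕ) (x : G) (hx : x ∈ γ G i) : L G := incl i (Additive.ofMul (cls i x hx))

theorem lie_def (a b : L G) : ⁅a, b⁆ = lieHom a b := rfl

theorem bracketHom_of (i j : ℕ) (a : Piece G i) (b : Piece G j) :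
    bracketHom G (DirectSum.of _ i a) (DirectSum.of _ j b) = DirectSum.of _ (i + j + 1) (br i j a b) := by
  rw [bracketHom, DirectSum.toAddMonoid_of, AddMonoidHom.flip_apply, DirectSum.toAddMonoid_of]
  rfl

/-- The bracket of the classes of `x` and `y` is the class of `[x, y] = x y x⁻¹ y⁻¹`. -/
theorem lie_toL {i j : ℕ} {x y : G} (hx : x ∈ γ G i) (hy : y ∈ γ G j) :
    ⁅toL i x hx, toL j y hy⁆ = toL (i + j + 1) ⁅x, y⁆ (commutator_mem_γ hx hy) :=
  bracketHom_of i j (Additive.ofMul (cls i x hx)) (Additive.ofMul (cls j y hy))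

theorem toL_mul {i : ℕ} {x y : G} (hx : x ∈ γ G i) (hy : y ∈ γ G i) :
    toL i (x * y) (mul_mem hx hy) = toL i x hx + toL i y hy := by
  rw [toL, cls_mul, ofMul_mul, map_add]; rfl

theorem toL_inv {i : ℕ} {x : G} (hx : x ∈ γ G i) :
    toL i x⁻¹ (inv_mem hx) = - toL i x hx := by
  rw [toL, cls_inv, ofMul_inv, map_neg]; rfl

theorem toL_one {i : ℕ} (h : (1 : G) ∈ γ G i) : toL i (1 : G) h = 0 := by
  rw [toL, cls_eq_one (one_mem _), ofMul_one, map_zero]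

theorem toL_conj {i : ℕ} {x : G} (hx : x ∈ γ G i) (g : G) :
    toL i (g * x * g⁻¹) (conj_mem_γ hx g) = toL i x hx := by
  rw [toL, cls_conj hx g]; rfl

theorem toL_congr {i j : ℕ} {x y : G} {hx : x ∈ γ G i} {hy : y ∈ γ G j} (hij : i = j)
    (hxy : x = y) : toL i x hx = toL j y hy := by
  subst hij; subst hxy; rfl

/-- `L(G)` is additively generated by the homogeneous elements. -/
theorem L_induction {p : L G → Prop} (h0 : p 0) (hadd : ∀ a b, p a → p b → p (a + b))
    (hom : ∀ i x hx, p (toL i x hx)) (a : L G) : p a := by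
  refine DirectSum.induction_on a h0 (fun i x => ?_) hadd
  obtain ⟨⟨x, hx⟩, rfl⟩ := QuotientGroup.mk_surjective (s := γsub G i) x.toMul
  exact hom i x hx

theorem add_lie' (a b c : L G) : ⁅a + b, c⁆ = ⁅a, c⁆ + ⁅b, c⁆ := by simp [lie_def]

theorem lie_add' (a b c : L G) : ⁅a, b + c⁆ = ⁅a, b⁆ + ⁅a, c⁆ := by simp [lie_def]

theorem zero_lie' (a : L G) : ⁅(0 : L G), a⁆ = 0 := by simp [lie_def]

theorem lie_zero' (a : L G) : ⁅a, (0 : L G)⁆ = 0 := by simp [lie_def]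

theorem lie_skew' (a b : L G) : ⁅a, b⁆ = -⁅b, a⁆ := by
  induction a using L_induction with
  | h0 => rw [zero_lie', lie_zero', neg_zero]
  | hadd a a' ha ha' => rw [add_lie', lie_add', ha, ha', neg_add]
  | hom i x hx =>
    induction b using L_induction with
    | h0 => rw [zero_lie', lie_zero', neg_zero]
    | hadd b b' hb hb' => rw [add_lie', lie_add', hb, hb', neg_add]
    | hom j y hy =>
      rw [lie_toL, lie_toL, ← toL_inv]
      exact toL_congr (by omega) (commutatorElement_inv y x).symm

theorem lie_self' (a : L G) : ⁅a, a⁆ = 0 := by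
  induction a using L_induction with
  | h0 => exact zero_lie' 0
  | hadd a b ha hb =>
    rw [add_lie', lie_add', lie_add', ha, hb, lie_skew' b a, zero_add, add_zero, add_neg_cancel]
  | hom i x hx =>
    rw [lie_toL]
    exact (toL_congr rfl (commutatorElement_self x)).trans (toL_one (one_mem _))

theorem jacobi_toL {i j k : ℕ} {x y z : G} (hx : x ∈ γ G i) (hy : y ∈ γ G j) (hz : z ∈ γ G k) :
    ⁅⁅toL i x hx, toL j y hy⁆, toL k z hz⁆ + ⁅⁅toL j y hy, toL k z hz⁆, toL i x hx⁆ +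
      ⁅⁅toL k z hz, toL i x hx⁆, toL j y hy⁆ = 0 := by
  have h1 := commutator_mem_γ (commutator_mem_γ hx hy) (conj_mem_γ hz y)
  have h2 := commutator_mem_γ (commutator_mem_γ hy hz) (conj_mem_γ hx z)
  have h3 := commutator_mem_γ (commutator_mem_γ hz hx) (conj_mem_γ hy x)
  have e2 : j + k + 1 + i + 1 = i + j + 1 + k + 1 := by omega
  have e3 : k + i + 1 + j + 1 = i + j + 1 + k + 1 := by omega
  have t1 : ⁅⁅toL i x hx, toL j y hy⁆, toL k z hz⁆ = toL (i + j + 1 + k + 1) _ h1 := by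
    rw [← toL_conj hz y, lie_toL, lie_toL]
  have t2 : ⁅⁅toL j y hy, toL k z hz⁆, toL i x hx⁆ = toL (i + j + 1 + k + 1) _ (e2 ▸ h2) := by
    rw [← toL_conj hx z, lie_toL, lie_toL]
    exact toL_congr e2 rfl
  have t3 : ⁅⁅toL k z hz, toL i x hx⁆, toL j y hy⁆ = toL (i + j + 1 + k + 1) _ (e3 ▸ h3) := by
    rw [← toL_conj hy x, lie_toL, lie_toL]
    exact toL_congr e3 rfl
  rw [t1, t2, t3, ← toL_mul, ← toL_mul]
  exact (toL_congr rfl (commutatorElement_commutatorElement_conj_mul x y z)).trans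
    (toL_one (one_mem _))

theorem leibniz_lie' (a b c : L G) : ⁅a, ⁅b, c⁆⁆ = ⁅⁅a, b⁆, c⁆ + ⁅b, ⁅a, c⁆⁆ := by
  induction a using L_induction with
  | h0 => simp only [zero_lie', lie_zero', add_zero]
  | hadd a a' ha ha' => simp only [add_lie', lie_add', ha, ha']; abel
  | hom i x hx =>
    induction b using L_induction with
    | h0 => simp only [zero_lie', lie_zero', add_zero]
    | hadd b b' hb hb' => simp only [add_lie', lie_add', hb, hb']; abel
    | hom j y hy =>
      induction c using L_induction with
      | h0 => simp only [lie_zero', add_zero]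
      | hadd c c' hc hc' => simp only [lie_add', hc, hc']; abel
      | hom k z hz =>
        have h := jacobi_toL hx hy hz
        have h1 := lie_skew' (toL i x hx) ⁅toL j y hy, toL k z hz⁆
        have h2 := lie_skew' (toL j y hy) ⁅toL i x hx, toL k z hz⁆
        have h3 : ⁅⁅toL i x hx, toL k z hz⁆, toL j y hy⁆ =
            -⁅⁅toL k z hz, toL i x hx⁆, toL j y hy⁆ := by
          rw [lie_skew' (toL i x hx) (toL k z hz), lie_def (-_), map_neg]
          rfl
        rw [h1, h2, h3, neg_neg]
        exact neg_eq_of_add_eq_zero_left (by rw [← h]; abel)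

/-- With the other convention, the bracket of the classes of `x` and `y` is also the class of
`x⁻¹ y⁻¹ x y`. -/
theorem lie_toL' {i j : ℕ} {x y : G} (hx : x ∈ γ G i) (hy : y ∈ γ G j) :
    ⁅toL i x hx, toL j y hy⁆ = toL (i + j + 1) (x⁻¹ * y⁻¹ * x * y)
      (by simpa [commutatorElement_def] using commutator_mem_γ (inv_mem hx) (inv_mem hy)) := by
  have h := lie_toL (inv_mem hx) (inv_mem hy)
  rw [toL_inv, toL_inv, lie_def, map_neg, map_neg, AddMonoidHom.neg_apply, neg_neg] at h
  exact h.trans (toL_congr rfl (by simp [commutatorElement_def]))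

/-- `L(G)` is a Lie ring, hence a Lie algebra over `ℤ`. -/
instance : LieRing (L G) where
  add_lie := add_lie'
  lie_add := lie_add'
  lie_self := lie_self'
  leibniz_lie := leibniz_lie'

end LieRing

end LCS

/-! ### The groups `G_φ` and `G_α` -/

namespace IAut

/-- The commutator convention `[a, b] = a⁻¹ b⁻¹ a b`. -/
def comm {G : Type*} [Group G] (a b : G) : G := a⁻¹ * b⁻¹ * a * b

/-- The free group `F_n` of rank `n`, with basis `FreeGroup.of i`. -/
abbrev F (n : ℕ) : Type := FreeGroup (Fin n)

/-- `IA(F_n)`: the automorphisms of `F_n` that act trivially on `F_n / [F_n, F_n]`. -/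
def IA (n : ℕ) : Subgroup (MulAut (F n)) where
  carrier := {f | ∀ x, Abelianization.of (f x) = Abelianization.of x}
  one_mem' _ := rfl
  mul_mem' {f g} hf hg x := (hf (g x)).trans (hg x)
  inv_mem' {f} hf x := by
    rw [← hf (f⁻¹ x), MulAut.apply_inv_self]

/-- The semidirect product `G_φ = F_k ⋊ F_n` given by `φ : F_n → IA(F_k)`. -/
abbrev Gφ {n k : ℕ} (φ : F n →* IA k) : Type := F k ⋊[(IA k).subtype.comp φ] F n

section Magnus

variable {n : ℕ}

/-- The endomorphism `x_i ↦ x_i [x_j, x_k]`, `x_l ↦ x_l` for `l ≠ i`. -/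
def εEnd (i j k : Fin n) : F n →* F n :=
  FreeGroup.lift fun l =>
    if l = i then FreeGroup.of i * comm (FreeGroup.of j) (FreeGroup.of k) else FreeGroup.of l

/-- The inverse of `εEnd i j k` if `k ≠ i`. -/
def εInv (i j k : Fin n) : F n →* F n :=
  FreeGroup.lift fun l =>
    if l = i then
      if j = i then FreeGroup.of k * FreeGroup.of i * (FreeGroup.of k)⁻¹
      else FreeGroup.of i * (comm (FreeGroup.of j) (FreeGroup.of k))⁻¹
    else FreeGroup.of l

theorem εInv_comp_εEnd {i j k : Fin n} (h : k ≠ i) :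
    (εInv i j k).comp (εEnd i j k) = MonoidHom.id _ := by
  ext l
  by_cases hl : l = i <;> by_cases hj : j = i <;>
    simp [εInv, εEnd, comm, hl, hj, h, mul_assoc]

theorem εEnd_comp_εInv {i j k : Fin n} (h : k ≠ i) :
    (εEnd i j k).comp (εInv i j k) = MonoidHom.id _ := by
  ext l
  by_cases hl : l = i <;> by_cases hj : j = i <;>
    simp [εInv, εEnd, comm, hl, hj, h, mul_assoc]

/-- For `k ≠ i`, the automorphism `x_i ↦ x_i [x_j, x_k]`, `x_l ↦ x_l` for `l ≠ i`, in `IA(F_n)`. -/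
def ε (i j k : Fin n) (h : k ≠ i) : IA n :=
  ⟨(εEnd i j k).toMulEquiv (εInv i j k) (εInv_comp_εEnd h) (εEnd_comp_εInv h), fun x => by
    refine DFunLike.congr_fun (?_ : Abelianization.of.comp (εEnd i j k) = Abelianization.of) x
    ext l
    by_cases hl : l = i <;> simp [εEnd, comm, hl, mul_comm]⟩

end Magnus

/-- `φ_α : F_3 → IA(F_3)`, which sends the `i`-th basis element `u_i` to the automorphism
`t_i ↦ t_i α_i`, `t_l ↦ t_l` for `l ≠ i`, where `α_i = [t_j, t_k]` with `(j, k) = α i`.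
Such an `α_i` is admissible when `k ≠ i`. -/
def φ (α : Fin 3 → Fin 3 × Fin 3) (h : ∀ i, (α i).2 ≠ i) : F 3 →* IA 3 :=
  FreeGroup.lift fun i => ε i (α i).1 (α i).2 (h i)

/-- The group `G_α = F_3 ⋊ F_3` given by `φ_α`. -/
abbrev Gα (α : Fin 3 → Fin 3 × Fin 3) (h : ∀ i, (α i).2 ≠ i) : Type := Gφ (φ α h)

/-! Three triples `α`; the indices `1, 2, 3` are written `0, 1, 2`. -/

/-- `a_1 = ([t_2, t_3], [t_1, t_3], [t_1, t_2])`. -/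
def a₁ : Fin 3 → Fin 3 × Fin 3 := ![(1, 2), (0, 2), (0, 1)]

/-- `a_2 = ([t_2, t_3], [t_2, t_3], [t_1, t_2])`. -/
def a₂ : Fin 3 → Fin 3 × Fin 3 := ![(1, 2), (1, 2), (0, 1)]

/-- `a_3 = ([t_2, t_3], [t_2, t_3], [t_3, t_2])`. -/
def a₃ : Fin 3 → Fin 3 × Fin 3 := ![(1, 2), (1, 2), (2, 1)]

theorem a₁_admissible : ∀ i, (a₁ i).2 ≠ i := by decide

theorem a₂_admissible : ∀ i, (a₂ i).2 ≠ i := by decide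

theorem a₃_admissible : ∀ i, (a₃ i).2 ≠ i := by decide

/-- `G_{a_1}` -/
abbrev G₁ : Type := Gα a₁ a₁_admissible

/-- `G_{a_2}` -/
abbrev G₂ : Type := Gα a₂ a₂_admissible

/-- `G_{a_3}` -/
abbrev G₃ : Type := Gα a₃ a₃_admissible

end IAut

/-! The invariant is the number of pairs of vectors with zero bracket in degree one, modulo two.
Since `IA` acts trivially on the abelianization, the degree-one part of L = L(G_α) is free abelian
on the classes of t_1, t_2, t_3, u_1, u_2, u_3, and it represents L/[L,L]. The bracket of two such
classes lies in [L,L] modulo [[L,L],L], so neither side of this pairing depends on the grading; an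
isomorphism need not respect degrees. Modulo two the pairing is `bracketForm` on F_2^6.

Two bounds identify it. The relations [u_i,t_i] = α_i and [u_i,t_l] = 0 for l ≠ i give every bracket
in terms of the form (`lie_combination`), so a zero of the form modulo two gives a bracket in 2L +
[[L,L],L]. Conversely, a homomorphism from G_α to a group of class two over F_2 (`classTwoHom`)
yields functionals that recover the form (`degTwo_lie`). Hence an isomorphism maps zero pairs
injectively to zero pairs (`card_commutingPairs_le`).

The counts are 316 + 24k, with k the number of nonzero t in F_2^3 such that t_i⟨α_i,t⟩ = 0 for all
i, where α_i is read through the cross product. Here k = 0, 1, 3. -/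

namespace LCS

/-! ### Functionals on L(G) and the span of brackets -/

section Functional

variable {G A : Type*} [Group G] [AddCommGroup A]

/-- An additive functional on one homogeneous component, extended by zero to `L(G)`. -/
def ofPiece (k : ℕ) (g : Piece G k →+ A) : L G →+ A :=
  g.comp (DFinsupp.evalAddMonoidHom k : (⨁ i : ℕ, Piece G i) →+ Piece G k)

theorem ofPiece_toL_same {k : ℕ} (g : Piece G k →+ A) {x : G} (hx : x ∈ γ G k) :
    ofPiece k g (toL k x hx) = g (Additive.ofMul (cls k x hx)) :=
  congrArg g (DirectSum.of_eq_same k _)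

theorem ofPiece_toL_of_ne {k i : ℕ} (g : Piece G k →+ A) {x : G} (hx : x ∈ γ G i) (h : i ≠ k) :
    ofPiece k g (toL i x hx) = 0 :=
  (congrArg g (DirectSum.of_eq_of_ne i k _ h.symm)).trans (map_zero g)

/-- The additive subgroup generated by all brackets. -/
def derivedSubgroup (M : Type*) [LieRing M] : AddSubgroup M :=
  AddSubgroup.closure {x | ∃ a b : M, x = ⁅a, b⁆}

/-- Commutators generate the next term of the series, and their classes are brackets. So L/[L,L]
comes from degree one alone. -/
theorem toL_succ_mem_derivedSubgroup {i : ℕ} {x : G} (hx : x ∈ γ G (i + 1)) :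
    toL (i + 1) x hx ∈ derivedSubgroup (L G) := by
  -- `toL` takes a proof of membership, so the induction over the closure has to produce that proof
  -- together with the claim.
  suffices h : ∃ hx : x ∈ γ G (i + 1), toL (i + 1) x hx ∈ derivedSubgroup (L G) from h.2
  have hx' : x ∈ Subgroup.closure {g | ∃ a ∈ γ G i, ∃ b ∈ (⊤ : Subgroup G), ⁅a, b⁆ = g} := hx
  clear hx
  induction hx' using Subgroup.closure_induction with
  | mem x h =>
    obtain ⟨a, ha, b, hb, rfl⟩ := h
    refine ⟨Subgroup.commutator_mem_commutator ha hb,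
      AddSubgroup.subset_closure ⟨toL i a ha, toL 0 b hb, ?_⟩⟩
    exact (lie_toL (i := i) (j := 0) ha hb).symm
  | one => exact ⟨one_mem _, by rw [toL_one]; exact zero_mem _⟩
  | mul x y hx hy ihx ihy =>
    obtain ⟨hx, h⟩ := ihx
    obtain ⟨hy, h'⟩ := ihy
    exact ⟨mul_mem hx hy, by rw [toL_mul hx hy]; exact add_mem h h'⟩
  | inv x hx ihx =>
    obtain ⟨hx, h⟩ := ihx
    exact ⟨inv_mem hx, by rw [toL_inv hx]; exact neg_mem h⟩

end Functional

/-! ### Groups of class two from bilinear forms -/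

/-- The group on `V × A` with multiplication `(v, a) (w, b) = (v + w, a + b + β v w)`. -/
@[ext] structure BilinExt {R V A : Type*} [CommRing R] [AddCommGroup V] [AddCommGroup A]
    [Module R V] [Module R A] (β : V →ₗ[R] V →ₗ[R] A) where
  fst : V
  snd : A

namespace BilinExt

variable {R V A : Type*} [CommRing R] [AddCommGroup V] [AddCommGroup A]
  [Module R V] [Module R A] {β : V →ₗ[R] V →ₗ[R] A}

instance : Mul (BilinExt β) := ⟨fun x y => ⟨x.fst + y.fst, x.snd + y.snd + β x.fst y.fst⟩⟩
instance : One (BilinExt β) := ⟨⟨0, 0⟩⟩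
instance : Inv (BilinExt β) := ⟨fun x => ⟨-x.fst, -x.snd + β x.fst x.fst⟩⟩

@[simp] theorem fst_mul (x y : BilinExt β) : (x * y).fst = x.fst + y.fst := rfl
@[simp] theorem snd_mul (x y : BilinExt β) : (x * y).snd = x.snd + y.snd + β x.fst y.fst := rfl
@[simp] theorem fst_one : (1 : BilinExt β).fst = 0 := rfl
@[simp] theorem snd_one : (1 : BilinExt β).snd = 0 := rfl
@[simp] theorem fst_inv (x : BilinExt β) : (x⁻¹).fst = -x.fst := rfl
@[simp] theorem snd_inv (x : BilinExt β) : (x⁻¹).snd = -x.snd + β x.fst x.fst := rfl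

instance : Group (BilinExt β) :=
  Group.ofLeftAxioms
    (fun x y z => by
      ext
      · simp [add_assoc]
      · simp only [snd_mul, fst_mul, map_add, LinearMap.add_apply]; abel)
    (fun x => by ext <;> simp)
    (fun x => by ext <;> simp)

theorem conj_eq (x y : BilinExt β) :
    x * y * x⁻¹ = ⟨y.fst, y.snd + (β x.fst y.fst - β y.fst x.fst)⟩ := by
  ext
  · simp
  · simp only [snd_mul, fst_mul, snd_inv, fst_inv, map_add, map_neg, LinearMap.add_apply]; abel

/-- Only the antisymmetrization of β survives. In characteristic two an alternating form cannot be
halved, so any β with the right antisymmetrization serves instead. -/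
theorem commutatorElement_eq (x y : BilinExt β) :
    ⁅x, y⁆ = ⟨0, β x.fst y.fst - β y.fst x.fst⟩ := by
  rw [commutatorElement_def, conj_eq]
  ext
  · simp
  · simp only [snd_mul, snd_inv, fst_inv, map_neg]; abel

theorem comm_eq (x y : BilinExt β) :
    IAut.comm x y = ⟨0, β x.fst y.fst - β y.fst x.fst⟩ := by
  have h : IAut.comm x y = ⁅x⁻¹, y⁻¹⁆ := by simp [IAut.comm, commutatorElement_def]
  rw [h, commutatorElement_eq]
  simp

/-- The projection to the first component. -/
def fstHom (β : V →ₗ[R] V →ₗ[R] A) : BilinExt β →* Multiplicative V where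
  toFun x := Multiplicative.ofAdd x.fst
  map_one' := rfl
  map_mul' _ _ := rfl

variable {G : Type*} [Group G] (f : G →* BilinExt β)

theorem fst_eq_zero {i : ℕ} {x : G} (hx : x ∈ γ G (i + 1)) : (f x).fst = 0 := by
  have h : γ G (i + 1) ≤ ((fstHom β).comp f).ker := by
    refine Subgroup.commutator_le.2 fun a _ b _ => ?_
    rw [MonoidHom.mem_ker, map_commutatorElement]
    exact commutatorElement_eq_one_iff_mul_comm.2 (mul_comm _ _)
  exact congrArg Multiplicative.toAdd (h hx)

/-- Commutators have first coordinate zero and are therefore central. With numbering from 0, `γ G 2`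
is the third term of the series. -/
theorem map_eq_one {x : G} (hx : x ∈ γ G 2) : f x = 1 := by
  have h : γ G 2 ≤ f.ker := by
    refine Subgroup.commutator_le.2 fun a ha b _ => ?_
    rw [MonoidHom.mem_ker, map_commutatorElement, commutatorElement_eq, fst_eq_zero f ha]
    ext <;> simp
  exact h hx

/-- The functional on `L(G)` given by the first component of `f` in degree one. -/
def degOne : L G →+ V :=
  ofPiece 0 (MonoidHom.toAdditiveLeft
    (QuotientGroup.lift (γsub G 0) (((fstHom β).comp f).comp (γ G 0).subtype)
      fun _ hx => congrArg Multiplicative.ofAdd (fst_eq_zero f (Subgroup.mem_subgroupOf.1 hx))))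

/-- The functional on `L(G)` given by the second component of `f` in degree two. -/
def degTwo : L G →+ A :=
  ofPiece 1 (MonoidHom.toAdditiveLeft
    (QuotientGroup.lift (γsub G 1)
      (MonoidHom.mk' (fun x : γ G 1 => Multiplicative.ofAdd (f x).snd) fun x y => by
        -- The cross term β vanishes because elements of `γ G 1` have first coordinate zero.
        rw [← ofAdd_add, Subgroup.coe_mul, map_mul, snd_mul, fst_eq_zero f x.2]
        simp)
      fun x hx => congrArg (fun y : BilinExt β => Multiplicative.ofAdd y.snd)
        (map_eq_one f (x := (x : G)) (Subgroup.mem_subgroupOf.1 hx))))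

theorem degTwo_toL {i : ℕ} {x : G} (hx : x ∈ γ G i) (hi : i = 1) :
    degTwo f (toL i x hx) = (f x).snd := by
  subst hi
  exact ofPiece_toL_same _ hx

theorem degOne_toL_of_ne {i : ℕ} {x : G} (hx : x ∈ γ G i) (h : i ≠ 0) :
    degOne f (toL i x hx) = 0 :=
  ofPiece_toL_of_ne _ _ h

theorem degTwo_toL_of_ne {i : ℕ} {x : G} (hx : x ∈ γ G i) (h : i ≠ 1) :
    degTwo f (toL i x hx) = 0 :=
  ofPiece_toL_of_ne _ _ h

theorem degOne_toL {x : G} (hx : x ∈ γ G 0) : degOne f (toL 0 x hx) = (f x).fst :=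
  ofPiece_toL_same _ hx

theorem degOne_lie (a b : L G) : degOne f ⁅a, b⁆ = 0 := by
  induction a using L_induction with
  | h0 => simp
  | hadd a a' ha ha' => rw [add_lie, map_add, ha, ha', add_zero]
  | hom i x hx =>
    induction b using L_induction with
    | h0 => simp
    | hadd b b' hb hb' => rw [lie_add, map_add, hb, hb', add_zero]
    | hom j y hy =>
      rw [lie_toL]
      exact degOne_toL_of_ne f _ (by omega)

/-- By biadditivity homogeneous elements suffice. Only two elements of degree one have a bracket of
degree two; in all other cases both sides vanish. -/
theorem degTwo_lie (a b : L G) :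
    degTwo f ⁅a, b⁆ = β (degOne f a) (degOne f b) - β (degOne f b) (degOne f a) := by
  induction a using L_induction with
  | h0 => simp
  | hadd a a' ha ha' =>
    simp only [add_lie, map_add, ha, ha', LinearMap.add_apply]; abel
  | hom i x hx =>
    induction b using L_induction with
    | h0 => simp
    | hadd b b' hb hb' => simp only [lie_add, map_add, hb, hb', LinearMap.add_apply]; abel
    | hom j y hy =>
      rw [lie_toL]
      obtain rfl | hi := eq_or_ne i 0
      · obtain rfl | hj := eq_or_ne j 0
        · rw [degOne_toL, degOne_toL]
          rw [degTwo_toL f _ rfl, map_commutatorElement, commutatorElement_eq]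
        · rw [degOne_toL_of_ne f hy hj, degTwo_toL_of_ne f _ (by omega)]
          simp
      · rw [degOne_toL_of_ne f hx hi, degTwo_toL_of_ne f _ (by omega)]
        simp

end BilinExt

end LCS

/-! ### The bracket from degree one to degree two, in coordinates -/

namespace IAut

/-- A bilinear map on `R³` whose antisymmetrization is the cross product. -/
def halfCross {R : Type*} [CommRing R] (x y : Fin 3 → R) : Fin 3 → R :=
  ![x 1 * y 2, x 2 * y 0, x 0 * y 1]

section Forms

variable (R : Type*) [CommRing R] (α : Fin 3 → Fin 3 × Fin 3)

/-- The coordinates of the class of `α_i = [t_j, t_k]` in `γ_2(F_3) / γ_3(F_3)`. -/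
def commCoord (p : Fin 3 × Fin 3) : Fin 3 → R :=
  halfCross (Pi.single p.1 1) (Pi.single p.2 1) - halfCross (Pi.single p.2 1) (Pi.single p.1 1)

/-- A bilinear form whose antisymmetrization is the bracket of `L(G_α)` from degree one to degree
two. Vectors are written as pairs: the coordinates for the `t_i`, those for the `u_i`. -/
def halfForm : ((Fin 3 → R) × (Fin 3 → R)) →ₗ[R] ((Fin 3 → R) × (Fin 3 → R)) →ₗ[R]
    ((Fin 3 → R) × (Fin 3 → R)) :=
  LinearMap.mk₂ R
    (fun v w => (halfCross v.1 w.1 + ∑ i, (v.2 i * w.1 i) • commCoord R (α i),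
      halfCross v.2 w.2))
    (fun v v' w => by
      ext i
      · simp only [halfCross, Fin.sum_univ_three, Prod.fst_add, Prod.snd_add, Pi.add_apply,
          Pi.smul_apply, smul_eq_mul]
        fin_cases i <;> simp <;> ring
      · fin_cases i <;> simp [halfCross] <;> ring)
    (fun c v w => by
      ext i
      · simp only [halfCross, Fin.sum_univ_three, Prod.smul_fst, Prod.smul_snd, Pi.add_apply,
          Pi.smul_apply, smul_eq_mul]
        fin_cases i <;> simp <;> ring
      · fin_cases i <;> simp [halfCross] <;> ring)
    (fun v w w' => by
      ext i
      · simp only [halfCross, Fin.sum_univ_three, Prod.fst_add, Pi.add_apply,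
          Pi.smul_apply, smul_eq_mul]
        fin_cases i <;> simp <;> ring
      · fin_cases i <;> simp [halfCross] <;> ring)
    (fun c v w => by
      ext i
      · simp only [halfCross, Fin.sum_univ_three, Prod.smul_fst, Pi.add_apply,
          Pi.smul_apply, smul_eq_mul]
        fin_cases i <;> simp <;> ring
      · fin_cases i <;> simp [halfCross] <;> ring)

/-- The bracket of `L(G_α)` from degree one to degree two, in coordinates. -/
def bracketForm (v w : (Fin 3 → R) × (Fin 3 → R)) : (Fin 3 → R) × (Fin 3 → R) :=
  halfForm R α v w - halfForm R α w v

theorem bracketForm_apply (v w : (Fin 3 → R) × (Fin 3 → R)) :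
    bracketForm R α v w =
      (halfCross v.1 w.1 - halfCross w.1 v.1 +
        ∑ i, (v.2 i * w.1 i - w.2 i * v.1 i) • commCoord R (α i),
        halfCross v.2 w.2 - halfCross w.2 v.2) := by
  simp only [bracketForm, halfForm, LinearMap.mk₂_apply, Prod.mk_sub_mk, sub_smul,
    Finset.sum_sub_distrib]
  congr 1
  abel

/-- Pairs of vectors over `ZMod 2` with trivial bracket. -/
def commutingPairs : Finset (((Fin 3 → ZMod 2) × (Fin 3 → ZMod 2)) ×
    ((Fin 3 → ZMod 2) × (Fin 3 → ZMod 2))) :=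
  Finset.univ.filter fun p => bracketForm (ZMod 2) α p.1 p.2 = 0

end Forms

/-! ### Counting the zeros of the form over F_2 -/

section Count

/-- Vectors of length three as triples. -/
def tripleEquiv (S : Type*) : (Fin 3 → S) ≃ S × S × S where
  toFun v := (v 0, v 1, v 2)
  invFun p := ![p.1, p.2.1, p.2.2]
  left_inv v := by ext i; fin_cases i <;> rfl
  right_inv _ := rfl

theorem tripleEquiv_apply {S : Type*} (v : Fin 3 → S) :
    tripleEquiv S v = (v 0, v 1, v 2) := rfl

/-- Vectors of length three over `ZMod 2`, as triples. -/
abbrev Triple : Type := ZMod 2 × ZMod 2 × ZMod 2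

/-- Passing from functions to triples turns the condition on the 4096 pairs into explicit equations
that can be evaluated. -/
theorem card_commutingPairs (α : Fin 3 → Fin 3 × Fin 3)
    (P : (Triple × Triple) × (Triple × Triple) → Prop)
    [DecidablePred P]
    (h : ∀ v w, bracketForm (ZMod 2) α v w = 0 ↔
      P ((tripleEquiv _ v.1, tripleEquiv _ v.2), (tripleEquiv _ w.1, tripleEquiv _ w.2))) :
    (commutingPairs α).card = (Finset.univ.filter P).card := by
  let e := (tripleEquiv (ZMod 2)).prodCongr (tripleEquiv (ZMod 2))
  refine Finset.card_equiv (e.prodCongr e) fun p => ?_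
  simp only [commutingPairs, Finset.mem_filter, Finset.mem_univ, true_and]
  exact h p.1 p.2

/-- If both u-parts are 0, the t-parts are dependent: 22 pairs. Otherwise the u-parts are (u,0),
(0,u) or (u,u), with equal counts. For (u,0) a nonzero second t-part t' admits two first parts if ∑
u_i t'_i⟨α_i,t'⟩ = 0 and none otherwise; t' = 0 admits all eight. This gives 316 + 24k. Signs of the
α_i do not matter modulo two. -/
theorem card_commutingPairs_a₁ : (commutingPairs a₁).card = 316 := by
  rw [card_commutingPairs a₁ fun
    | ((⟨a, b, c⟩, ⟨x, y, z⟩), (⟨a', b', c'⟩, ⟨x', y', z'⟩)) =>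
      (y * z' = y' * z ∧ z * x' = z' * x ∧ x * y' = x' * y) ∧
        b * c' - b' * c + (x * a' - x' * a) = 0 ∧ c * a' - c' * a + (y * b' - y' * b) = 0 ∧
        a * b' - a' * b + (z * c' - z' * c) = 0]
  · decide +kernel
  · intro v w
    rw [bracketForm_apply, Prod.ext_iff, and_comm]
    simp [funext_iff, Fin.forall_fin_succ, Fin.sum_univ_three, halfCross, commCoord, a₁,
      tripleEquiv_apply, sub_eq_zero]

theorem card_commutingPairs_a₂ : (commutingPairs a₂).card = 340 := by
  rw [card_commutingPairs a₂ fun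
    | ((⟨a, b, c⟩, ⟨x, y, z⟩), (⟨a', b', c'⟩, ⟨x', y', z'⟩)) =>
      (y * z' = y' * z ∧ z * x' = z' * x ∧ x * y' = x' * y) ∧
        b * c' - b' * c + ((x * a' - x' * a) + (y * b' - y' * b)) = 0 ∧ c * a' - c' * a = 0 ∧
        a * b' - a' * b + (z * c' - z' * c) = 0]
  · decide +kernel
  · intro v w
    rw [bracketForm_apply, Prod.ext_iff, and_comm]
    simp [funext_iff, Fin.forall_fin_succ, Fin.sum_univ_three, halfCross, commCoord, a₂,
      tripleEquiv_apply, sub_eq_zero]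

theorem card_commutingPairs_a₃ : (commutingPairs a₃).card = 388 := by
  rw [card_commutingPairs a₃ fun
    | ((⟨a, b, c⟩, ⟨x, y, z⟩), (⟨a', b', c'⟩, ⟨x', y', z'⟩)) =>
      (y * z' = y' * z ∧ z * x' = z' * x ∧ x * y' = x' * y) ∧
        b * c' - b' * c + ((x * a' - x' * a) + (y * b' - y' * b) + (z * c' - z' * c)) = 0 ∧
        c * a' - c' * a = 0 ∧ a * b' - a' * b = 0]
  · decide +kernel
  · intro v w
    rw [bracketForm_apply, Prod.ext_iff, and_comm]
    simp [funext_iff, Fin.forall_fin_succ, Fin.sum_univ_three, halfCross, commCoord, a₃,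
      tripleEquiv_apply, sub_eq_zero]

end Count

end IAut

/-! ### Brackets forced by the relations -/

namespace IAut

open LCS

section LieRelations

variable {M : Type*} [LieRing M]

/-- The combination of the brackets `[X₁, X₂]`, `[X₂, X₀]`, `[X₀, X₁]` with given coefficients. -/
def wedge (X : Fin 3 → M) : (Fin 3 → ℤ) →ₗ[ℤ] M :=
  Fintype.linearCombination ℤ ![⁅X 1, X 2⁆, ⁅X 2, X 0⁆, ⁅X 0, X 1⁆]

theorem lie_linearCombination (X : Fin 3 → M) (n m : Fin 3 → ℤ) :
    ⁅Fintype.linearCombination ℤ X n, Fintype.linearCombination ℤ X m⁆ =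
      wedge X (halfCross n m - halfCross m n) := by
  simp only [wedge, Fintype.linearCombination_apply, Fin.sum_univ_three, halfCross, add_lie,
    lie_add, lie_zsmul, zsmul_lie, lie_self]
  rw [← lie_skew (X 1) (X 0), ← lie_skew (X 2) (X 1), ← lie_skew (X 0) (X 2)]
  simp [-lie_skew]
  module

theorem lie_eq_wedge (X : Fin 3 → M) (p : Fin 3 × Fin 3) :
    ⁅X p.1, X p.2⁆ = wedge X (commCoord ℤ p) := by
  rw [commCoord, ← lie_linearCombination, Fintype.linearCombination_apply_single,
    Fintype.linearCombination_apply_single, one_smul, one_smul]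

/-- The combination of the `T i` and the `U i` with given coefficients. -/
def combination (T U : Fin 3 → M) : ((Fin 3 → ℤ) × (Fin 3 → ℤ)) →ₗ[ℤ] M :=
  (Fintype.linearCombination ℤ T).coprod (Fintype.linearCombination ℤ U)

/-- This uses the relations only. The elementary brackets in `wedge` may be dependent, so it bounds
the bracket from one side; the functionals supply the other. -/
theorem lie_combination {α : Fin 3 → Fin 3 × Fin 3} {T U : Fin 3 → M}
    (h : ∀ i l, ⁅U i, T l⁆ = if l = i then ⁅T (α i).1, T (α i).2⁆ else 0)
    (v w : (Fin 3 → ℤ) × (Fin 3 → ℤ)) :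
    ⁅combination T U v, combination T U w⁆ =
      (wedge T).coprod (wedge U) (bracketForm ℤ α v w) := by
  have key : ∀ n m : Fin 3 → ℤ,
      ⁅Fintype.linearCombination ℤ U n, Fintype.linearCombination ℤ T m⁆ =
        wedge T (∑ i, (n i * m i) • commCoord ℤ (α i)) := by
    intro n m
    simp only [map_sum, map_smul, ← lie_eq_wedge, Fintype.linearCombination_apply,
      sum_lie, lie_sum, lie_zsmul, zsmul_lie, h]
    simp [smul_smul, mul_comm]
  rw [bracketForm_apply]
  simp only [combination, LinearMap.coprod_apply, add_lie, lie_add, lie_linearCombination, key]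
  rw [← lie_skew, key]
  simp only [sub_smul, Finset.sum_sub_distrib, map_add, map_sub]
  abel

end LieRelations

/-! ### Invariance of the count under Lie isomorphisms -/

/-- Reduction modulo two of pairs of vectors. -/
def reduceModTwo (v : (Fin 3 → ℤ) × (Fin 3 → ℤ)) : (Fin 3 → ZMod 2) × (Fin 3 → ZMod 2) :=
  (fun i => v.1 i, fun i => v.2 i)

theorem exists_two_smul_of_reduceModTwo_eq_zero {v : (Fin 3 → ℤ) × (Fin 3 → ℤ)}
    (h : reduceModTwo v = 0) : ∃ w, v = (2 : ℤ) • w := by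
  have h1 : ∀ i, (2 : ℤ) ∣ v.1 i := fun i =>
    (ZMod.intCast_zmod_eq_zero_iff_dvd _ 2).1 (congrFun (congrArg Prod.fst h) i)
  have h2 : ∀ i, (2 : ℤ) ∣ v.2 i := fun i =>
    (ZMod.intCast_zmod_eq_zero_iff_dvd _ 2).1 (congrFun (congrArg Prod.snd h) i)
  choose a ha using h1
  choose b hb using h2
  exact ⟨(a, b), Prod.ext (funext ha) (funext hb)⟩

theorem reduceModTwo_surjective (v : (Fin 3 → ZMod 2) × (Fin 3 → ZMod 2)) :
    ∃ w, reduceModTwo w = v := by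
  choose f hf using ZMod.intCast_surjective (n := 2)
  exact ⟨(fun i => f (v.1 i), fun i => f (v.2 i)), by simp [reduceModTwo, hf]⟩

theorem reduceModTwo_bracketForm (α : Fin 3 → Fin 3 × Fin 3) (v w : (Fin 3 → ℤ) × (Fin 3 → ℤ)) :
    reduceModTwo (bracketForm ℤ α v w) =
      bracketForm (ZMod 2) α (reduceModTwo v) (reduceModTwo w) := by
  have hs : ∀ i j : Fin 3, (((Pi.single i 1 : Fin 3 → ℤ) j : ℤ) : ZMod 2) =
      (Pi.single i 1 : Fin 3 → ZMod 2) j := by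
    intro i j
    by_cases h : j = i <;> simp [h]
  rw [bracketForm_apply, bracketForm_apply]
  ext i <;> fin_cases i <;>
    simp [reduceModTwo, halfCross, commCoord, Fin.sum_univ_three, hs]

/-- Generators of a Lie ring `M` modulo brackets, whose brackets are given by `bracketForm α` and
are, modulo two, as independent as this form allows. -/
structure QuadraticData (α : Fin 3 → Fin 3 × Fin 3) (M : Type*) [LieRing M] where
  T : Fin 3 → M
  U : Fin 3 → M
  lie_U_T : ∀ i l, ⁅U i, T l⁆ = if l = i then ⁅T (α i).1, T (α i).2⁆ else 0
  exists_sub_mem : ∀ x, ∃ v, x - combination T U v ∈ derivedSubgroup M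
  degOne : M →+ (Fin 3 → ZMod 2) × (Fin 3 → ZMod 2)
  degTwo : M →+ (Fin 3 → ZMod 2) × (Fin 3 → ZMod 2)
  degOne_lie : ∀ x y : M, degOne ⁅x, y⁆ = 0
  degTwo_lie : ∀ x y : M, degTwo ⁅x, y⁆ = bracketForm (ZMod 2) α (degOne x) (degOne y)
  degOne_combination : ∀ v, degOne (combination T U v) = reduceModTwo v

theorem map_eq_zero_of_mem_derivedSubgroup {M A : Type*} [LieRing M] [AddCommGroup A] (f : M →+ A)
    (h : ∀ x y : M, f ⁅x, y⁆ = 0) {x : M} (hx : x ∈ derivedSubgroup M) : f x = 0 := by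
  have : derivedSubgroup M ≤ f.ker := by
    refine (AddSubgroup.closure_le _).2 ?_
    rintro _ ⟨a, b, rfl⟩
    exact h a b
  exact this hx

theorem two_smul_eq_zero (v : (Fin 3 → ZMod 2) × (Fin 3 → ZMod 2)) : (2 : ℤ) • v = 0 := by
  rw [two_smul]
  ext i <;> exact CharTwo.add_self_eq_zero _

namespace QuadraticData

variable {α : Fin 3 → Fin 3 × Fin 3} {M : Type*} [LieRing M] (D : QuadraticData α M)

theorem degOne_eq {x : M} {v : (Fin 3 → ℤ) × (Fin 3 → ℤ)}
    (h : x - combination D.T D.U v ∈ derivedSubgroup M) : D.degOne x = reduceModTwo v := by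
  have h0 := map_eq_zero_of_mem_derivedSubgroup D.degOne D.degOne_lie h
  rwa [map_sub, sub_eq_zero, D.degOne_combination] at h0

/-- A functional modulo two that kills brackets factors through `degOne`. -/
theorem map_eq_zero (f : M →+ (Fin 3 → ZMod 2) × (Fin 3 → ZMod 2)) (hf : ∀ x y : M, f ⁅x, y⁆ = 0)
    {x : M} (hx : D.degOne x = 0) : f x = 0 := by
  obtain ⟨v, hv⟩ := D.exists_sub_mem x
  have h0 := map_eq_zero_of_mem_derivedSubgroup f hf hv
  -- Modulo brackets, x is twice a combination of generators.
  obtain ⟨w, rfl⟩ := exists_two_smul_of_reduceModTwo_eq_zero ((D.degOne_eq hv).symm.trans hx)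
  rwa [map_sub, sub_eq_zero, map_smul, map_zsmul, two_smul_eq_zero] at h0

/-- A functional modulo two that kills triple brackets kills the brackets allowed by the form. -/
theorem map_lie_eq_zero (f : M →+ (Fin 3 → ZMod 2) × (Fin 3 → ZMod 2))
    (hf : ∀ x y z : M, f ⁅⁅x, y⁆, z⁆ = 0) {x y : M}
    (hxy : bracketForm (ZMod 2) α (D.degOne x) (D.degOne y) = 0) : f ⁅x, y⁆ = 0 := by
  -- Since f kills [[M,M],M], the value f ⁅x, y⁆ depends only on x and y modulo brackets.
  have hd : ∀ x y : M, x ∈ derivedSubgroup M → f ⁅x, y⁆ = 0 := fun x y hx =>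
    map_eq_zero_of_mem_derivedSubgroup
      (AddMonoidHom.mk' (fun x => f ⁅x, y⁆) fun a b => by rw [add_lie, map_add])
      (fun a b => hf a b y) hx
  obtain ⟨v, hv⟩ := D.exists_sub_mem x
  obtain ⟨w, hw⟩ := D.exists_sub_mem y
  have h1 : f ⁅x, y⁆ = f ⁅combination D.T D.U v, y⁆ := by
    rw [← sub_eq_zero, ← map_sub, ← sub_lie, hd _ _ hv]
  have h2 : f ⁅combination D.T D.U v, y⁆ = f ⁅combination D.T D.U v, combination D.T D.U w⁆ := by
    rw [← sub_eq_zero, ← map_sub, ← lie_sub, ← lie_skew, map_neg, hd _ _ hw, neg_zero]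
  rw [D.degOne_eq hv, D.degOne_eq hw, ← reduceModTwo_bracketForm] at hxy
  obtain ⟨c, hc⟩ := exists_two_smul_of_reduceModTwo_eq_zero hxy
  rw [h1, h2, lie_combination D.lie_U_T, hc, map_smul, map_zsmul, two_smul_eq_zero]

set_option linter.constructorNameAsVariable false in
/-- An isomorphism induces an injection of the pairs with trivial bracket. -/
theorem card_commutingPairs_le (D : QuadraticData α M) {α' : Fin 3 → Fin 3 × Fin 3} {M' : Type*}
    [LieRing M'] (D' : QuadraticData α' M') (e : M ≃ₗ⁅ℤ⁆ M') :
    (commutingPairs α).card ≤ (commutingPairs α').card := by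
  choose lift hlift using reduceModTwo_surjective
  let s := fun v => combination D.T D.U (lift v)
  have hs : ∀ v, D.degOne (s v) = v := fun v => (D.degOne_combination _).trans (hlift v)
  let σ := fun v => D'.degOne (e (s v))
  have hσ : Function.Injective σ := by
    intro v w h
    have h0 : D'.degOne (e (s v - s w)) = 0 := by
      rw [map_sub, map_sub]
      exact sub_eq_zero.2 h
    -- The functional `D.degOne` ∘ e⁻¹ kills brackets, so it factors through `D'.degOne`. As `lift`
    -- need not be additive, this is applied to the difference `s v - s w`.
    have h1 := D'.map_eq_zero (D.degOne.comp (e.symm : M' →+ M))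
      (fun x y => (congrArg D.degOne (LieEquiv.map_lie e.symm x y)).trans (D.degOne_lie _ _)) h0
    change D.degOne (e.symm (e _)) = 0 at h1
    rwa [e.symm_apply_apply, map_sub, hs, hs, sub_eq_zero] at h1
  refine Finset.card_le_card_of_injOn (Prod.map σ σ) ?_ (hσ.prodMap hσ).injOn
  rintro ⟨v, w⟩ h
  simp only [commutingPairs, Finset.coe_filter, Finset.mem_univ, true_and, Set.mem_ofPred_eq] at h ⊢
  have he : ∀ x y, D'.degTwo (e ⁅x, y⁆) =
      bracketForm (ZMod 2) α' (D'.degOne (e x)) (D'.degOne (e y)) := fun x y => by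
    rw [LieEquiv.map_lie, D'.degTwo_lie]
  -- `D'.degTwo` ∘ e kills triple brackets, because `D'.degOne` vanishes on the inner one.
  have h1 := D.map_lie_eq_zero (D'.degTwo.comp (e : M →+ M')) (x := s v) (y := s w)
    (fun x y z => (he _ _).trans (by
      rw [LieEquiv.map_lie, D'.degOne_lie, bracketForm, map_zero, map_zero,
        LinearMap.zero_apply, sub_zero])) (by rwa [hs, hs])
  exact (he _ _).symm.trans h1

end QuadraticData

end IAut

/-! ### The data for L(G_α) -/

namespace IAut

open LCS SemidirectProduct

variable (α : Fin 3 → Fin 3 × Fin 3) (h : ∀ i, (α i).2 ≠ i)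

theorem φ_of_apply_of (i l : Fin 3) :
    ((φ α h (FreeGroup.of i) : IA 3) : MulAut (F 3)) (FreeGroup.of l) =
      if l = i then FreeGroup.of i * comm (FreeGroup.of (α i).1) (FreeGroup.of (α i).2)
      else FreeGroup.of l := by
  simp [φ, ε, εEnd]

/-- The form satisfies the defining relations of G_α; this makes the maps on the t_i and the u_i
compatible with the action. -/
theorem bracketForm_u_t (i l : Fin 3) :
    bracketForm (ZMod 2) α (0, Pi.single i 1) (Pi.single l 1, 0) =
      if l = i then bracketForm (ZMod 2) α (Pi.single (α i).1 1, 0) (Pi.single (α i).2 1, 0)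
      else 0 := by
  simp only [bracketForm_apply]
  have hc : ∀ v : Fin 3 → ZMod 2, halfCross 0 v = 0 ∧ halfCross v 0 = 0 := fun v => by
    constructor <;> ext i <;> fin_cases i <;> simp [halfCross]
  split_ifs with hl
  · subst hl
    simp [hc, commCoord, Pi.single_apply]
  · simp [hc, Pi.single_apply, hl]

/-- The images of the generators `t_i`. -/
def tHom : F 3 →* BilinExt (halfForm (ZMod 2) α) :=
  FreeGroup.lift fun i => ⟨(Pi.single i 1, 0), 0⟩

/-- The images of the generators `u_i`. -/
def uHom : F 3 →* BilinExt (halfForm (ZMod 2) α) :=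
  FreeGroup.lift fun i => ⟨(0, Pi.single i 1), 0⟩

theorem tHom_φ_of (i : Fin 3) :
    (tHom α).comp ((IA 3).subtype.comp (φ α h) (FreeGroup.of i)).toMonoidHom =
      (MulAut.conj (uHom α (FreeGroup.of i))).toMonoidHom.comp (tHom α) := by
  ext1 l
  have hb := bracketForm_u_t α i l
  simp only [bracketForm] at hb
  change tHom α (((φ α h (FreeGroup.of i) : IA 3) : MulAut (F 3)) (FreeGroup.of l)) =
    uHom α (FreeGroup.of i) * tHom α (FreeGroup.of l) * (uHom α (FreeGroup.of i))⁻¹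
  rw [φ_of_apply_of, BilinExt.conj_eq]
  simp only [tHom, uHom, FreeGroup.lift_apply_of, hb]
  split_ifs with hl
  · subst hl
    have hm : ∀ a b : F 3, FreeGroup.lift (fun i : Fin 3 =>
        (⟨(Pi.single i 1, 0), 0⟩ : BilinExt (halfForm (ZMod 2) α))) (comm a b) =
        comm (FreeGroup.lift (fun i : Fin 3 => ⟨(Pi.single i 1, 0), 0⟩) a)
          (FreeGroup.lift (fun i : Fin 3 => ⟨(Pi.single i 1, 0), 0⟩) b) := by
      intro a b
      simp only [comm, map_mul, map_inv]
    rw [map_mul, hm, BilinExt.comm_eq]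
    simp only [FreeGroup.lift_apply_of]
    ext1 <;> simp
  · simp

/-- Compatibility with the action passes to products and inverses, so the generators u_i suffice. -/
theorem tHom_φ (g : F 3) :
    (tHom α).comp ((IA 3).subtype.comp (φ α h) g).toMonoidHom =
      (MulAut.conj (uHom α g)).toMonoidHom.comp (tHom α) := by
  induction g using FreeGroup.induction_on with
  | C1 => ext1 l; simp
  | of i => exact tHom_φ_of α h i
  | inv_of i hi =>
    ext1 l
    -- Evaluating at the preimage of t_l under the automorphism cancels the latter.
    have hi' := DFunLike.congr_fun hi
      (((IA 3).subtype.comp (φ α h) (FreeGroup.of i))⁻¹ (FreeGroup.of l))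
    simp only [MonoidHom.comp_apply, MulEquiv.coe_toMonoidHom, MulAut.apply_inv_self] at hi'
    simp only [MonoidHom.comp_apply, MulEquiv.coe_toMonoidHom, map_inv] at hi' ⊢
    rw [hi']
    simp [mul_assoc]
  | mul a b ha hb =>
    ext1 l
    have ha' := DFunLike.congr_fun ha ((IA 3).subtype.comp (φ α h) b (FreeGroup.of l))
    have hb' := DFunLike.congr_fun hb (FreeGroup.of l)
    simp only [MonoidHom.comp_apply, MulEquiv.coe_toMonoidHom, map_mul, MulAut.mul_apply]
      at ha' hb' ⊢
    rw [ha', hb']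

/-- The homomorphism from `G_α` to a group of class two that detects `L(G_α)` in degrees one and
two, modulo two. -/
def classTwoHom : Gα α h →* BilinExt (halfForm (ZMod 2) α) :=
  SemidirectProduct.lift (tHom α) (uHom α) (tHom_φ α h)

theorem mem_γ_zero {G : Type*} [Group G] (x : G) : x ∈ γ G 0 := Subgroup.mem_top x

/-- The class of `t_i`. -/
def tClass (i : Fin 3) : L (Gα α h) := toL 0 (inl (FreeGroup.of i)) (mem_γ_zero _)

/-- The class of `u_i`. -/
def uClass (i : Fin 3) : L (Gα α h) := toL 0 (inr (FreeGroup.of i)) (mem_γ_zero _)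

/-- In G_α the commutator of u_i and t_i is t_i α_i t_i⁻¹, and conjugation does not change the
class. For l ≠ i, u_i commutes with t_l. -/
theorem lie_uClass_tClass (i l : Fin 3) :
    ⁅uClass α h i, tClass α h l⁆ =
      if l = i then ⁅tClass α h (α i).1, tClass α h (α i).2⁆ else 0 := by
  have hg : ⁅(inr (FreeGroup.of i) : Gα α h), (inl (FreeGroup.of l) : Gα α h)⁆ =
      inl (((φ α h (FreeGroup.of i) : IA 3) : MulAut (F 3)) (FreeGroup.of l) *
        (FreeGroup.of l)⁻¹) := by
    rw [commutatorElement_def, map_mul, map_inv]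
    congr 1
    exact (inl_aut (φ := (IA 3).subtype.comp (φ α h)) _ _).symm
  rw [uClass, tClass, lie_toL]
  rw [φ_of_apply_of] at hg
  split_ifs with hl
  · subst hl
    rw [tClass, tClass, lie_toL']
    refine (toL_congr rfl ?_).trans (toL_conj _ (inl (FreeGroup.of l)))
    rw [hg, if_pos rfl]
    simp only [map_mul, map_inv, comm]
  · rw [if_neg hl, mul_inv_cancel, map_one] at hg
    exact (toL_congr rfl hg).trans (toL_one (one_mem _))

theorem exists_sub_mem_derivedSubgroup (x : L (Gα α h)) :
    ∃ v, x - combination (tClass α h) (uClass α h) v ∈ derivedSubgroup (L (Gα α h)) := by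
  let S := (AddSubgroup.map (combination (tClass α h) (uClass α h)).toAddMonoidHom ⊤) ⊔
    derivedSubgroup (L (Gα α h))
  suffices hx : x ∈ S by
    obtain ⟨_, ⟨v, -, rfl⟩, z, hz, rfl⟩ := AddSubgroup.mem_sup.1 hx
    exact ⟨v, by simpa using hz⟩
  have ht : ∀ i, tClass α h i ∈ S := fun i => AddSubgroup.mem_sup_left
    ⟨(Pi.single i 1, 0), trivial, by
      simp [combination, Fintype.linearCombination_apply_single]⟩
  have hu : ∀ i, uClass α h i ∈ S := fun i => AddSubgroup.mem_sup_left
    ⟨(0, Pi.single i 1), trivial, by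
      simp [combination, Fintype.linearCombination_apply_single]⟩
  have hmul : ∀ x y : Gα α h, toL 0 x (mem_γ_zero _) ∈ S → toL 0 y (mem_γ_zero _) ∈ S →
      toL 0 (x * y) (mem_γ_zero _) ∈ S := fun x y hx hy => by
    rw [toL_mul (mem_γ_zero x) (mem_γ_zero y)]
    exact add_mem hx hy
  have hinv : ∀ x : Gα α h, toL 0 x (mem_γ_zero _) ∈ S → toL 0 x⁻¹ (mem_γ_zero _) ∈ S :=
    fun x hx => by
      rw [toL_inv (mem_γ_zero x)]
      exact neg_mem hx
  have hone : toL 0 (1 : Gα α h) (mem_γ_zero _) ∈ S := by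
    rw [toL_one]
    exact zero_mem S
  induction x using L_induction with
  | h0 => exact zero_mem S
  | hadd a b ha hb => exact add_mem ha hb
  | hom i x hx =>
    match i, hx with
    | 0, hx =>
      have hl : ∀ a : F 3, toL 0 (inl a : Gα α h) (mem_γ_zero _) ∈ S := by
        intro a
        induction a using FreeGroup.induction_on with
        | C1 => simpa only [map_one] using hone
        | of i => exact ht i
        | inv_of i hi => simpa only [map_inv] using hinv _ hi
        | mul a b ha hb => simpa only [map_mul] using hmul _ _ ha hb
      have hr : ∀ a : F 3, toL 0 (inr a : Gα α h) (mem_γ_zero _) ∈ S := by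
        intro a
        induction a using FreeGroup.induction_on with
        | C1 => simpa only [map_one] using hone
        | of i => exact hu i
        | inv_of i hi => simpa only [map_inv] using hinv _ hi
        | mul a b ha hb => simpa only [map_mul] using hmul _ _ ha hb
      have hx' := hmul _ _ (hl x.left) (hr x.right)
      simpa only [inl_left_mul_inr_right] using hx'
    | i + 1, hx => exact AddSubgroup.mem_sup_right (toL_succ_mem_derivedSubgroup hx)

/-- The structure of `L(G_α)` in degrees one and two, modulo two. -/
def quadraticData : QuadraticData α (L (Gα α h)) where
  T := tClass α h
  U := uClass α h
  lie_U_T := lie_uClass_tClass α h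
  exists_sub_mem := exists_sub_mem_derivedSubgroup α h
  degOne := BilinExt.degOne (classTwoHom α h)
  degTwo := BilinExt.degTwo (classTwoHom α h)
  degOne_lie := BilinExt.degOne_lie _
  degTwo_lie := BilinExt.degTwo_lie _
  degOne_combination v := by
    have ht : ∀ i, BilinExt.degOne (classTwoHom α h) (tClass α h i) = (Pi.single i 1, 0) := by
      intro i
      rw [tClass, BilinExt.degOne_toL]
      simp [classTwoHom, tHom]
    have hu : ∀ i, BilinExt.degOne (classTwoHom α h) (uClass α h i) = (0, Pi.single i 1) := by
      intro i
      rw [uClass, BilinExt.degOne_toL]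
      simp [classTwoHom, uHom]
    simp only [combination, LinearMap.coprod_apply, Fintype.linearCombination_apply, map_add,
      map_zsmul, ht, hu, Fin.sum_univ_three]
    ext i <;> fin_cases i <;> simp [reduceModTwo]

end IAut

theorem mainTheorem5 :
    IsEmpty (LCS.L IAut.G₁ ≃ₗ⁅ℤ⁆ LCS.L IAut.G₂) ∧
    IsEmpty (LCS.L IAut.G₁ ≃ₗ⁅ℤ⁆ LCS.L IAut.G₃) ∧
    IsEmpty (LCS.L IAut.G₂ ≃ₗ⁅ℤ⁆ LCS.L IAut.G₃) := by
  have D₁ := IAut.quadraticData IAut.a₁ IAut.a₁_admissible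
  have D₂ := IAut.quadraticData IAut.a₂ IAut.a₂_admissible
  have D₃ := IAut.quadraticData IAut.a₃ IAut.a₃_admissible
  have h₁ := IAut.card_commutingPairs_a₁
  have h₂ := IAut.card_commutingPairs_a₂
  have h₃ := IAut.card_commutingPairs_a₃
  refine ⟨⟨fun e => ?_⟩, ⟨fun e => ?_⟩, ⟨fun e => ?_⟩⟩
  -- The larger count would inject into the smaller one, hence the inverse isomorphism.
  · have := D₂.card_commutingPairs_le D₁ e.symm
    omega
  · have := D₃.card_commutingPairs_le D₁ e.symm
    omega
  · have := D₃.card_commutingPairs_le D₂ e.symm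
    omega
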